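/- Let $M>0$ and $0\le X_1<X_2$, put $X_\Sigma=X_1+X_2$, $\Omega=\sqrt{2/(MX_\Sigma)}$, $G_0=\dfrac{1}{s^2M(s^2+\Omega^2)}$, $N_1=\frac{X_2}{X_\Sigma}s^2+\frac1{MX_\Sigma}$, $N_2=\frac{X_1}{X_\Sigma}s^2+\frac1{MX_\Sigma}$. The undamped linearized two-machine model with local phase-angle measurement $y=\theta$, load disturbances $d_1,d_2$ at the machines, control input $u$ (active power injected at the measurement bus) and performance variable $z=\omega_1-\omega_2=\dot\delta_1-\dot\delta_2$ has the transfer functions $$G_{zd_1}=-G_{zd_2}=s^3G_0,\quad G_{yd_i}=G_0N_i,\quad G_{zu}=sG_0(N_1-N_2),\quad G_{yu}=MX_\Sigma\, G_0N_1N_2 .$$ Let $|q_1|=\sqrt{1/(MX_2)}$ and $|q_2|=\sqrt{1/(MX_1)}$ ($|q_2|=\infty$ if $X_1=0$) be the moduli of the zeros of $N_1$ and $N_2$. Let $K$ be a proper real-rational transfer function such that the feedback $u=-Ky$ internally stabilizes the loop, and let $$R_{zd_i}=1-G_{zu}K(1+G_{yu}K)^{-1}G_{yd_i}G_{zd_i}^{-1},\qquad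 i=1,2,$$ be its disturbance response ratios. Suppose that, for some frequency interval $(\underline\omega,\bar\omega)\subseteq(|q_1|,|q_2|)$ (with $\bar\omega=\infty$ allowed if $X_1=0$), $$\int_{\underline\omega}^{\bar\omega}\ln|R_{zd_i}(j\omega)|\,d\omega<0,\qquad i=1,2 .$$ Then $$\sup_{\omega}\max\bigl(|R_{zd_1}(j\omega)|,|R_{zd_2}(j\omega)|\bigr)>1,$$ and this amplification necessarily occurs outside the interval: there is a frequency $0\le\omega<\underline\omega$ with $\max(|R_{zd_1}(j\omega)|,|R_{zd_2}(j\omega)|)>1$ and, if $X_1>0$ (that is, if $|q_2|<\infty$), there is also a frequency $\omega>\bar\omega$ with $\max(|R_{zd_1}(j\omega)|,|R_{zd_2}(j\omega)|)>1$. -/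

import Mathlib

noncomputable section

namespace TwoMachine

/-! ### Real-rational transfer functions

A scalar transfer function is an element of the field `ℝ(s)`. Its value at a point is computed from
the reduced fraction, so removable singularities are removed. -/

/-- A transfer function is proper: its relative degree is nonnegative. -/
def IsProper (G : RatFunc ℝ) : Prop := G.num.degree ≤ G.denom.degree

/-- A transfer function is stable: proper, without poles in the closed right half plane. -/
def IsStable (G : RatFunc ℝ) : Prop :=
  IsProper G ∧ ∀ s : ℂ, 0 ≤ s.re → Polynomial.aeval s G.denom ≠ 0

/-- The frequency response `G(jω)`. -/
def freqResp (G : RatFunc ℝ) (ω : ℝ) : ℂ :=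
  RatFunc.eval (algebraMap ℝ ℂ) (Complex.I * (ω : ℂ)) G

/-- Internal stability of the feedback loop of a plant `G` and the controller `u = -K y`: the loop is
well-posed and the closed-loop transfer functions from every injection point to every signal of the
loop are stable. -/
def InternallyStabilizes (G K : RatFunc ℝ) : Prop :=
  1 + G * K ≠ 0 ∧
    IsStable (1 + G * K)⁻¹ ∧
    IsStable (K * (1 + G * K)⁻¹) ∧
    IsStable (G * (1 + G * K)⁻¹) ∧
    IsStable (G * K * (1 + G * K)⁻¹)

/-! ### The undamped linearized two-machine model

`M` is the inertia constant of both machines and `X₁`, `X₂` are the (linearized) reactances between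
the machines and the control bus. The inputs are the load disturbances `d₁`, `d₂` at the machines and
the active power injection `u` at the control bus; `δ₁`, `δ₂`, `θ` are the phase angles at the
machines and at the control bus. -/

/-- The Laplace variable `s`. -/
abbrev s : RatFunc ℝ := RatFunc.X

/-- The undamped frequency `Ω = √(2 / (M X_Σ))` of the inter-area mode, `X_Σ = X₁ + X₂`. -/
def Om (M X₁ X₂ : ℝ) : ℝ := Real.sqrt (2 / (M * (X₁ + X₂)))

/-- `G₀ = 1 / (s² M (s² + Ω²))`. -/
def G0 (M X₁ X₂ : ℝ) : RatFunc ℝ :=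
  (s ^ 2 * RatFunc.C M * (s ^ 2 + RatFunc.C (Om M X₁ X₂ ^ 2)))⁻¹

/-- `N₁ = (X₂ / X_Σ) (s² + 1 / (M X₂))`, multiplied out. -/
def N₁ (M X₁ X₂ : ℝ) : RatFunc ℝ :=
  RatFunc.C (X₂ / (X₁ + X₂)) * s ^ 2 + RatFunc.C (1 / (M * (X₁ + X₂)))

/-- `N₂ = (X₁ / X_Σ) (s² + 1 / (M X₁))`, multiplied out so that it is also right for `X₁ = 0`. -/
def N₂ (M X₁ X₂ : ℝ) : RatFunc ℝ :=
  RatFunc.C (X₁ / (X₁ + X₂)) * s ^ 2 + RatFunc.C (1 / (M * (X₁ + X₂)))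

/-- `N₃ = M X_Σ N₁ N₂`. -/
def N₃ (M X₁ X₂ : ℝ) : RatFunc ℝ :=
  RatFunc.C (M * (X₁ + X₂)) * N₁ M X₁ X₂ * N₂ M X₁ X₂

/-- Transfer functions from the disturbances `d` to the machine angles `δ`. -/
def Gδd (M X₁ X₂ : ℝ) : Matrix (Fin 2) (Fin 2) (RatFunc ℝ) :=
  G0 M X₁ X₂ •
    !![s ^ 2 + RatFunc.C (Om M X₁ X₂ ^ 2 / 2), RatFunc.C (Om M X₁ X₂ ^ 2 / 2);
       RatFunc.C (Om M X₁ X₂ ^ 2 / 2), s ^ 2 + RatFunc.C (Om M X₁ X₂ ^ 2 / 2)]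

/-- Transfer functions from the control input `u` to the machine angles `δ`. -/
def Gδu (M X₁ X₂ : ℝ) : Fin 2 → RatFunc ℝ :=
  ![G0 M X₁ X₂ * N₁ M X₁ X₂, G0 M X₁ X₂ * N₂ M X₁ X₂]

/-- Transfer functions from the disturbances `d` to the local measurement `y = θ`. -/
def Gyd (M X₁ X₂ : ℝ) : Fin 2 → RatFunc ℝ :=
  ![G0 M X₁ X₂ * N₁ M X₁ X₂, G0 M X₁ X₂ * N₂ M X₁ X₂]

/-- Transfer function from the control input `u` to the local measurement `y = θ`. -/
def Gyu (M X₁ X₂ : ℝ) : RatFunc ℝ := G0 M X₁ X₂ * N₃ M X₁ X₂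

/-- Transfer functions from the disturbances to the performance variable
`z = ω₁ - ω₂ = s (δ₁ - δ₂)`. -/
def Gzd (M X₁ X₂ : ℝ) (i : Fin 2) : RatFunc ℝ :=
  s * (Gδd M X₁ X₂ 0 i - Gδd M X₁ X₂ 1 i)

/-- Transfer function from the control input to the performance variable `z = s (δ₁ - δ₂)`. -/
def Gzu (M X₁ X₂ : ℝ) : RatFunc ℝ := s * (Gδu M X₁ X₂ 0 - Gδu M X₁ X₂ 1)

/-- The disturbance response ratio
`R_{zd_i} = 1 - G_zu K (1 + G_yu K)⁻¹ G_{yd_i} G_{zd_i}⁻¹` of the controller `u = -K y`. -/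
def Rzd (M X₁ X₂ : ℝ) (K : RatFunc ℝ) (i : Fin 2) : RatFunc ℝ :=
  1 - Gzu M X₁ X₂ * K * (1 + Gyu M X₁ X₂ * K)⁻¹ * Gyd M X₁ X₂ i * (Gzd M X₁ X₂ i)⁻¹

/-- `|R_{zd_i}(jω)|`. -/
def absR (M X₁ X₂ : ℝ) (K : RatFunc ℝ) (i : Fin 2) (ω : ℝ) : ℝ :=
  ‖freqResp (Rzd M X₁ X₂ K i) ω‖

/-- The modulus `|q₁| = √(1 / (M X₂))` of the zero pair of `N₁`. -/
def absq₁ (M X₂ : ℝ) : ℝ := Real.sqrt (1 / (M * X₂))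

/-- The modulus `|q₂| = √(1 / (M X₁))` of the zero pair of `N₂`, which is `∞` if `X₁ = 0`. -/
def absq₂ (M X₁ : ℝ) : EReal :=
  if X₁ = 0 then ⊤ else ((Real.sqrt (1 / (M * X₁)) : ℝ) : EReal)

/-- The frequency interval `(a, b)`, where `b = ∞` is allowed. -/
def band (a : ℝ) (b : EReal) : Set ℝ := {ω : ℝ | a < ω ∧ (ω : EReal) < b}

end TwoMachine

end

namespace TwoMachine

/-! Since `Gzd` is antisymmetric in the two machines, weighting the ratios by `N₂` and `N₁` cancels
the control terms and leaves `N₂ R₁ + N₁ R₂ = N₁ + N₂`. On the imaginary axis `N₁`, `N₂` are real,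
both positive below `|q₁|` and both negative above `|q₂|`, so off poles `1` is there a strict convex
combination of the ratios. As `1` is an extreme point of the unit disc, lack of amplification on
such a range would force `R₁ = 1` at infinitely many frequencies, hence identically
(`exists_one_lt_max_absR`). The attenuation integral rules this out and also makes the band
nonempty. -/

/-- Both disturbance response ratios are tied together by the zeros of `N₁` and `N₂`. -/
lemma N₂_mul_Rzd_add_N₁_mul_Rzd (M X₁ X₂ : ℝ) (K : RatFunc ℝ) :
    N₂ M X₁ X₂ * Rzd M X₁ X₂ K 0 + N₁ M X₁ X₂ * Rzd M X₁ X₂ K 1 =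
      N₁ M X₁ X₂ + N₂ M X₁ X₂ := by
  have h : Gzd M X₁ X₂ 1 = -Gzd M X₁ X₂ 0 := by
    simp only [Gzd, Gδd, Matrix.smul_apply, Matrix.of_apply, Matrix.cons_val', Matrix.cons_val_zero,
      Matrix.cons_val_one, Matrix.cons_val_fin_one, smul_eq_mul]
    ring
  simp only [Rzd, h, Gyd, Matrix.cons_val_zero, Matrix.cons_val_one, inv_neg]
  ring

/-- The poles of a transfer function on the imaginary axis are finite in number. -/
lemma finite_setOf_eval₂_denom_eq_zero (G : RatFunc ℝ) :
    {ω : ℝ | Polynomial.eval₂ (algebraMap ℝ ℂ) (Complex.I * (ω : ℂ)) G.denom = 0}.Finite := by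
  have hne : G.denom.map (algebraMap ℝ ℂ) ≠ 0 :=
    (Polynomial.map_ne_zero_iff (algebraMap ℝ ℂ).injective).2 G.denom_ne_zero
  have hinj : Function.Injective fun ω : ℝ => Complex.I * (ω : ℂ) :=
    (mul_right_injective₀ Complex.I_ne_zero).comp Complex.ofReal_injective
  refine ((Polynomial.finite_setOfPred_isRoot hne).preimage hinj.injOn).subset fun ω hω => ?_
  simpa [Polynomial.IsRoot, Polynomial.eval_map] using hω

/-- A transfer function whose frequency response is `1` at infinitely many frequencies is `1`. -/
lemma eq_one_of_freqResp_eq_one {G : RatFunc ℝ} {I : Set ℝ} (hI : I.Infinite)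
    (h : ∀ ω ∈ I, freqResp G ω = 1) : G = 1 := by
  have hinj : Function.Injective fun ω : ℝ => Complex.I * (ω : ℂ) :=
    (mul_right_injective₀ Complex.I_ne_zero).comp Complex.ofReal_injective
  have heq : G.num.map (algebraMap ℝ ℂ) = G.denom.map (algebraMap ℝ ℂ) := by
    refine Polynomial.eq_of_infinite_eval_eq _ _ ((hI.image hinj.injOn).mono ?_)
    rintro _ ⟨ω, hω, rfl⟩
    have h1 := h ω hω
    rw [freqResp, RatFunc.eval] at h1
    rw [Set.mem_ofPred_eq, Polynomial.eval_map, Polynomial.eval_map]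
    -- Poles need no exclusion: division by zero gives `0`, not `1`.
    exact eq_of_div_eq_one h1
  have hnd := Polynomial.map_injective _ (algebraMap ℝ ℂ).injective heq
  rw [← RatFunc.num_div_denom G, hnd]
  exact div_self (RatFunc.algebraMap_ne_zero G.denom_ne_zero)

lemma freqResp_C_mul_X_sq_add_C (a b ω : ℝ) :
    freqResp (RatFunc.C a * s ^ 2 + RatFunc.C b) ω = ((b - a * ω ^ 2 : ℝ) : ℂ) := by
  have h : RatFunc.C a * s ^ 2 + RatFunc.C b = algebraMap (Polynomial ℝ) (RatFunc ℝ)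
      (Polynomial.C a * Polynomial.X ^ 2 + Polynomial.C b) := by
    simp [RatFunc.algebraMap_C, RatFunc.algebraMap_X]
  rw [h, freqResp, RatFunc.eval_algebraMap]
  simp [mul_pow]
  ring

lemma eval₂_denom_C_mul_X_sq_add_C (a b : ℝ) (z : ℂ) :
    Polynomial.eval₂ (algebraMap ℝ ℂ) z (RatFunc.C a * s ^ 2 + RatFunc.C b).denom ≠ 0 := by
  have h : RatFunc.C a * s ^ 2 + RatFunc.C b = algebraMap (Polynomial ℝ) (RatFunc ℝ)
      (Polynomial.C a * Polynomial.X ^ 2 + Polynomial.C b) := by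
    simp [RatFunc.algebraMap_C, RatFunc.algebraMap_X]
  rw [h, RatFunc.denom_algebraMap]
  simp

/-- The identity of `N₂_mul_Rzd_add_N₁_mul_Rzd` at a frequency that is not a pole. -/
lemma freqResp_Rzd_identity {M X₁ X₂ : ℝ} {K : RatFunc ℝ} {ω : ℝ}
    (h₀ : Polynomial.eval₂ (algebraMap ℝ ℂ) (Complex.I * (ω : ℂ)) (Rzd M X₁ X₂ K 0).denom ≠ 0)
    (h₁ : Polynomial.eval₂ (algebraMap ℝ ℂ) (Complex.I * (ω : ℂ)) (Rzd M X₁ X₂ K 1).denom ≠ 0) :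
    freqResp (N₂ M X₁ X₂) ω * freqResp (Rzd M X₁ X₂ K 0) ω +
        freqResp (N₁ M X₁ X₂) ω * freqResp (Rzd M X₁ X₂ K 1) ω =
      freqResp (N₁ M X₁ X₂) ω + freqResp (N₂ M X₁ X₂) ω := by
  have hN₁ : Polynomial.eval₂ (algebraMap ℝ ℂ) (Complex.I * (ω : ℂ)) (N₁ M X₁ X₂).denom ≠ 0 :=
    eval₂_denom_C_mul_X_sq_add_C _ _ _
  have hN₂ : Polynomial.eval₂ (algebraMap ℝ ℂ) (Complex.I * (ω : ℂ)) (N₂ M X₁ X₂).denom ≠ 0 :=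
    eval₂_denom_C_mul_X_sq_add_C _ _ _
  have hmul : ∀ {p q : RatFunc ℝ},
      Polynomial.eval₂ (algebraMap ℝ ℂ) (Complex.I * (ω : ℂ)) p.denom ≠ 0 →
      Polynomial.eval₂ (algebraMap ℝ ℂ) (Complex.I * (ω : ℂ)) q.denom ≠ 0 →
      Polynomial.eval₂ (algebraMap ℝ ℂ) (Complex.I * (ω : ℂ)) (p * q).denom ≠ 0 := by
    intro p q hp hq h
    have := Polynomial.eval₂_eq_zero_of_dvd_of_eval₂_eq_zero (algebraMap ℝ ℂ) _
      (RatFunc.denom_mul_dvd p q) h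
    rw [Polynomial.eval₂_mul] at this
    exact mul_ne_zero hp hq this
  unfold freqResp
  rw [← RatFunc.eval_mul _ _ hN₂ h₀, ← RatFunc.eval_mul _ _ hN₁ h₁,
    ← RatFunc.eval_add _ _ (hmul hN₂ h₀) (hmul hN₁ h₁), ← RatFunc.eval_add _ _ hN₁ hN₂,
    N₂_mul_Rzd_add_N₁_mul_Rzd]

/-- If a proper convex combination of two points of the closed unit disc is `1`, the points
are `1`. -/
lemma eq_one_of_weighted_sum_eq {a b : ℝ} (hab : 0 < a ∧ 0 < b ∨ a < 0 ∧ b < 0) {z w : ℂ}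
    (hz : ‖z‖ ≤ 1) (hw : ‖w‖ ≤ 1) (h : (a : ℂ) * z + b * w = b + a) : z = 1 := by
  have hre := congrArg Complex.re h
  simp only [Complex.add_re, Complex.re_ofReal_mul, Complex.ofReal_re] at hre
  have hz1 := (Complex.re_le_norm z).trans hz
  have hw1 := (Complex.re_le_norm w).trans hw
  -- Real parts are at most `1`, and their average with weights of one sign is `1`.
  have hzre : z.re = 1 := by
    rcases hab with ⟨ha, hb⟩ | ⟨ha, hb⟩ <;> refine le_antisymm hz1 ?_ <;> nlinarith
  have hsq : z.re ^ 2 + z.im ^ 2 ≤ 1 := by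
    rw [sq, sq, ← Complex.normSq_apply, ← Complex.sq_norm]
    exact pow_le_one₀ (norm_nonneg z) hz
  have him : z.im = 0 := by nlinarith [sq_nonneg z.im]
  exact Complex.ext hzre him

/-- At infinitely many frequencies at which `N₁(jω)` and `N₂(jω)` have the same sign, a controller
that changes the response to the first disturbance amplifies one of the disturbances at one of
them. -/
lemma exists_one_lt_max_absR {M X₁ X₂ : ℝ} {K : RatFunc ℝ} (hR : Rzd M X₁ X₂ K 0 ≠ 1)
    {I : Set ℝ} (hI : I.Infinite) {n₁ n₂ : ℝ → ℝ}
    (hn₁ : ∀ ω, freqResp (N₁ M X₁ X₂) ω = (n₁ ω : ℂ))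
    (hn₂ : ∀ ω, freqResp (N₂ M X₁ X₂) ω = (n₂ ω : ℂ))
    (hsign : ∀ ω ∈ I, 0 < n₂ ω ∧ 0 < n₁ ω ∨ n₂ ω < 0 ∧ n₁ ω < 0) :
    ∃ ω ∈ I, 1 < max (absR M X₁ X₂ K 0 ω) (absR M X₁ X₂ K 1 ω) := by
  by_contra! hle
  -- The identity may be evaluated only off the poles; dropping these finitely many points keeps the
  -- set infinite.
  refine hR (eq_one_of_freqResp_eq_one
    ((hI.sdiff (finite_setOf_eval₂_denom_eq_zero (Rzd M X₁ X₂ K 0))).sdiff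
      (finite_setOf_eval₂_denom_eq_zero (Rzd M X₁ X₂ K 1))) ?_)
  rintro ω ⟨⟨hω, h₀⟩, h₁⟩
  have hid := freqResp_Rzd_identity h₀ h₁
  rw [hn₁, hn₂] at hid
  exact eq_one_of_weighted_sum_eq (hsign ω hω) ((le_max_left _ _).trans (hle ω hω))
    ((le_max_right _ _).trans (hle ω hω)) hid

/-- A nonempty band determines its end points. -/
lemma le_and_le_of_band_subset {a c : ℝ} {b d : EReal} (hne : (band a b).Nonempty)
    (h : band a b ⊆ band c d) : c ≤ a ∧ b ≤ d := by
  obtain ⟨x, hax, hxb⟩ := hne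
  constructor
  · by_contra! hac
    -- Staying below `x` keeps `y` in the smaller band, while `y < c` puts it outside the larger
    -- one.
    obtain ⟨y, hay, hy⟩ := exists_between (lt_min hac hax)
    have := (h ⟨hay, (EReal.coe_lt_coe_iff.2 (hy.trans_le (min_le_right _ _))).trans hxb⟩).1
    exact lt_asymm this (hy.trans_le (min_le_left _ _))
  · by_contra! hdb
    obtain ⟨y, hy, hyb⟩ := EReal.lt_iff_exists_real_btwn.1 (max_lt hdb hxb)
    have hxy : x < y := EReal.coe_lt_coe_iff.1 ((le_max_right _ _).trans_lt hy)
    have := (h ⟨hax.trans hxy, hyb⟩).2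
    exact lt_asymm this ((le_max_left _ _).trans_lt hy)

end TwoMachine

theorem proposition5 (M X₁ X₂ : ℝ) (hM : 0 < M) (hX₁ : 0 ≤ X₁) (hX : X₁ < X₂)
    (K : RatFunc ℝ) (hK : TwoMachine.IsProper K)
    (hstab : TwoMachine.InternallyStabilizes (TwoMachine.Gyu M X₁ X₂) K)
    (ωlo : ℝ) (ωhi : EReal)
    (hband : TwoMachine.band ωlo ωhi ⊆
      TwoMachine.band (TwoMachine.absq₁ M X₂) (TwoMachine.absq₂ M X₁))
    (hatt : ∀ i : Fin 2,
      ∫ ω in TwoMachine.band ωlo ωhi, Real.log (TwoMachine.absR M X₁ X₂ K i ω) < 0) :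
    (1 : EReal) < (⨆ ω : ℝ,
        ((max (TwoMachine.absR M X₁ X₂ K 0 ω) (TwoMachine.absR M X₁ X₂ K 1 ω) : ℝ) : EReal)) ∧
      (∃ ω : ℝ, 0 ≤ ω ∧ ω < ωlo ∧
        1 < max (TwoMachine.absR M X₁ X₂ K 0 ω) (TwoMachine.absR M X₁ X₂ K 1 ω)) ∧
      (0 < X₁ → ∃ ω : ℝ, ωhi < (ω : EReal) ∧
        1 < max (TwoMachine.absR M X₁ X₂ K 0 ω) (TwoMachine.absR M X₁ X₂ K 1 ω)) := by
  have hX₂ : 0 < X₂ := hX₁.trans_lt hX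
  have hXpos : 0 < X₁ + X₂ := by linarith
  have hR : TwoMachine.Rzd M X₁ X₂ K 0 ≠ 1 := by
    intro h
    -- A ratio equal to `1` makes the log integral zero.
    simpa [TwoMachine.absR, h, TwoMachine.freqResp] using hatt 0
  have hne : (TwoMachine.band ωlo ωhi).Nonempty := by
    by_contra h
    simpa [Set.not_nonempty_iff_eq_empty.1 h] using hatt 0
  obtain ⟨hlo, hhi⟩ := TwoMachine.le_and_le_of_band_subset hne hband
  have hform : ∀ x ω : ℝ, 1 / (M * (X₁ + X₂)) - x / (X₁ + X₂) * ω ^ 2 =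
      (1 - M * x * ω ^ 2) / (M * (X₁ + X₂)) := fun x ω => by field_simp
  have hn₁ : ∀ ω, TwoMachine.freqResp (TwoMachine.N₁ M X₁ X₂) ω =
      (((1 - M * X₂ * ω ^ 2) / (M * (X₁ + X₂)) : ℝ) : ℂ) := fun ω => by
    rw [← hform]; exact TwoMachine.freqResp_C_mul_X_sq_add_C _ _ _
  have hn₂ : ∀ ω, TwoMachine.freqResp (TwoMachine.N₂ M X₁ X₂) ω =
      (((1 - M * X₁ * ω ^ 2) / (M * (X₁ + X₂)) : ℝ) : ℂ) := fun ω => by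
    rw [← hform]; exact TwoMachine.freqResp_C_mul_X_sq_add_C _ _ _
  have hMXpos : 0 < M * (X₁ + X₂) := mul_pos hM hXpos
  have hq₁ : 0 < TwoMachine.absq₁ M X₂ := Real.sqrt_pos.2 (by positivity)
  have hlow : ∃ ω : ℝ, 0 ≤ ω ∧ ω < ωlo ∧
      1 < max (TwoMachine.absR M X₁ X₂ K 0 ω) (TwoMachine.absR M X₁ X₂ K 1 ω) := by
    -- On `(0, |q₁|)` both numerators are positive, `N₁` having the smaller zero.
    obtain ⟨ω, hω, h⟩ := TwoMachine.exists_one_lt_max_absR hR (Set.Ioo_infinite hq₁) hn₁ hn₂ <| by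
      intro ω hω
      have h1 : M * X₂ * ω ^ 2 < 1 := by
        have := (Real.lt_sqrt hω.1.le).1 hω.2
        rwa [lt_div_iff₀ (by positivity), mul_comm] at this
      have h2 : M * X₁ * ω ^ 2 ≤ M * X₂ * ω ^ 2 := by gcongr
      exact Or.inl ⟨div_pos (by linarith) hMXpos, div_pos (by linarith) hMXpos⟩
    exact ⟨ω, hω.1.le, hω.2.trans_le hlo, h⟩
  refine ⟨?_, hlow, fun hpos => ?_⟩
  · obtain ⟨ω, -, -, h⟩ := hlow
    exact lt_iSup_iff.2 ⟨ω, by exact_mod_cast h⟩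
  · rw [TwoMachine.absq₂, if_neg hpos.ne'] at hhi
    -- Beyond the finite `|q₂|` both numerators are negative.
    obtain ⟨ω, hω, h⟩ := TwoMachine.exists_one_lt_max_absR hR
      (Set.Ioi_infinite (Real.sqrt (1 / (M * X₁)))) hn₁ hn₂ <| by
      intro ω hω
      have h1 : 1 < M * X₁ * ω ^ 2 := by
        have := (Real.sqrt_lt' ((Real.sqrt_nonneg _).trans_lt hω)).1 hω
        rwa [div_lt_iff₀ (by positivity), mul_comm] at this
      have h2 : M * X₁ * ω ^ 2 ≤ M * X₂ * ω ^ 2 := by gcongr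
      exact Or.inr ⟨div_neg_of_neg_of_pos (by linarith) hMXpos,
        div_neg_of_neg_of_pos (by linarith) hMXpos⟩
    exact ⟨ω, hhi.trans_lt (EReal.coe_lt_coe_iff.2 hω), h⟩
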